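/- Let $\mathbb{M}^n=(\mathbb{R}^n,\|\cdot\|)$ be a Minkowski space, i.e. a real normed space of finite dimension $n\ge 1$, with unit ball $B$. A convex body is a compact convex set $K$ with more than one point. For a convex body $K$ let $$D(K)=\sup_{x,y\in K}\|x-y\|,\qquad R(K)=\inf\{\rho>0:\exists c,\ K\subset c+\rho B\},\qquad r(K)=\sup\{\rho>0:\exists c,\ c+\rho B\subset K\}$$ (with $r(K)=0$ if $K$ has empty interior) be its diameter, circumradius and inradius, let $$s(K)=\inf\{\rho>0:\exists c,\ -K\subset c+\rho K\}$$ be its Minkowski asymmetry, and let $j(K)=R(K)/D(K)$ be its Jung ratio. The body $K$ is complete if $D(K\cup\{x\})>D(K)$ for every $x\notin K$. Put $$j(\mathbb{M}^n)=\sup\{j(K): K \text{ a convex body}\},\qquad s(\mathbb{M}^n)=\max\{s(K): K\text{ a complete convex body}\}.$$ Then, for every complete convex body $K$ in $\mathbb{M}^n$, the supremum $j(\mathbb{M}^n)$ is finite, the maximum $s(\mathbb{M}^n)$ exists, and $$\frac{r(K)}{D(K)}=\frac{1}{s(K)+1}\ \ge\ \frac{1}{s(\mathbb{M}^n)+1},$$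 where equality holds in the inequality if and only if $j(K)=j(\mathbb{M}^n)$. -/

import Mathlib

open scoped Pointwise

noncomputable section

namespace MinkowskiSpace

/-- The Minkowski asymmetry `s(K)`: the infimum of all `ρ > 0` such that `-K ⊆ c + ρ K`
for some point `c`. -/
def asymmetry {E : Type*} [NormedAddCommGroup E] [NormedSpace ℝ E] (K : Set E) : ℝ :=
  sInf {ρ : ℝ | 0 < ρ ∧ ∃ c : E, -K ⊆ c +ᵥ (ρ • K)}

/-- The circumradius `R(K)`: the infimum of all `ρ > 0` such that `K` lies in a translate
of `ρ B`, where `B` is the unit ball of the norm. -/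
def circumradius {E : Type*} [NormedAddCommGroup E] (K : Set E) : ℝ :=
  sInf {ρ : ℝ | 0 < ρ ∧ ∃ c : E, K ⊆ Metric.closedBall c ρ}

/-- The inradius `r(K)`: the supremum of all `ρ > 0` such that `K` contains a translate
of `ρ B`. It is `0` (the supremum of the empty set) when `K` has no interior points. -/
def inradius {E : Type*} [NormedAddCommGroup E] (K : Set E) : ℝ :=
  sSup {ρ : ℝ | 0 < ρ ∧ ∃ c : E, Metric.closedBall c ρ ⊆ K}

/-- The Jung ratio `j(K) = R(K) / D(K)`; the diameter is taken in the norm of the space. -/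
def jungRatio {E : Type*} [NormedAddCommGroup E] (K : Set E) : ℝ :=
  circumradius K / Metric.diam K

/-- The convex bodies over which the Jung constant is taken: compact convex sets with
more than one point (so that `D(K) > 0`). -/
def bodies (E : Type*) [NormedAddCommGroup E] [NormedSpace ℝ E] : Set (ConvexBody E) :=
  {K | (K : Set E).Nontrivial}

/-- The complete bodies: adding any point outside `K` strictly increases the diameter. -/
def completeBodies (E : Type*) [NormedAddCommGroup E] [NormedSpace ℝ E] :
    Set (ConvexBody E) :=
  {K | K ∈ bodies E ∧
    ∀ x : E, x ∉ (K : Set E) → Metric.diam (K : Set E) < Metric.diam ((K : Set E) ∪ {x})}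

/-- The set of all values `j(K)`, `K` a convex body. -/
def jungRatios (E : Type*) [NormedAddCommGroup E] [NormedSpace ℝ E] : Set ℝ :=
  (fun K : ConvexBody E => jungRatio (K : Set E)) '' bodies E

/-- The set of all values `s(K)`, `K` a complete body. -/
def completeAsymmetries (E : Type*) [NormedAddCommGroup E] [NormedSpace ℝ E] : Set ℝ :=
  (fun K : ConvexBody E => asymmetry (K : Set E)) '' completeBodies E

/-- The Jung constant of the space. -/
def jungConstant (E : Type*) [NormedAddCommGroup E] [NormedSpace ℝ E] : ℝ :=
  sSup (jungRatios E)

/-- The asymmetry constant of the space: the largest Minkowski asymmetry of its complete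
bodies. -/
def asymmetryConstant (E : Type*) [NormedAddCommGroup E] [NormedSpace ℝ E] : ℝ :=
  sSup (completeAsymmetries E)

end MinkowskiSpace

end

open Metric Set TopologicalSpace

namespace MinkowskiSpace

variable {E : Type*} [NormedAddCommGroup E]

/-! ### Circumradius: attainment and Hausdorff continuity. -/

section Circumradius

/-! A complete body `K` of diameter `D` contains every point within `D` of all of `K`
(`mem_of_forall_dist_le`). Hence a circumball of radius `R` gives a concentric ball of radius `D -
R` in `K`, and conversely an inscribed ball of radius `ρ` forces `K` into the concentric ball of
radius `D - ρ`; so `r = D - R` (`inradius_eq`). These concentric balls also give `s = R / (D - R)`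
(`asymmetry_eq`). Thus `r / D = 1 / (s + 1)` and `j = 1 - 1 / (s + 1)`, so `s` and `j` order
complete bodies alike. It remains to maximise `j`: compactness yields a maximiser, and completing it
keeps the diameter without lowering `R`. -/

theorem circumradius_le {S : Set E} {c : E} {ρ : ℝ} (hρ : 0 ≤ ρ) (h : S ⊆ closedBall c ρ) :
    circumradius S ≤ ρ := by
  refine le_of_forall_pos_le_add fun ε hε => ?_
  exact csInf_le ⟨0, fun _ hx => hx.1.le⟩
    ⟨by positivity, c, h.trans (closedBall_subset_closedBall (by linarith))⟩

theorem circumradius_nonneg (S : Set E) : 0 ≤ circumradius S :=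
  Real.sInf_nonneg fun _ hx => hx.1.le

theorem exists_subset_closedBall_of_circumradius_lt {S : Set E} (hS : Bornology.IsBounded S)
    {a : ℝ} (ha : circumradius S < a) : ∃ c, S ⊆ closedBall c a := by
  have hne : {ρ : ℝ | 0 < ρ ∧ ∃ c : E, S ⊆ closedBall c ρ}.Nonempty := by
    obtain ⟨ρ, hρ, h⟩ := hS.subset_closedBall_lt 0 (0 : E)
    exact ⟨ρ, hρ, 0, h⟩
  obtain ⟨ρ, ⟨-, c, hc⟩, hlt⟩ := exists_lt_of_csInf_lt hne ha
  exact ⟨c, hc.trans (closedBall_subset_closedBall hlt.le)⟩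

theorem diam_le_two_mul_circumradius {S : Set E} (hS : Bornology.IsBounded S) :
    diam S ≤ 2 * circumradius S := by
  refine le_of_forall_pos_le_add fun ε hε => ?_
  obtain ⟨c, hc⟩ := exists_subset_closedBall_of_circumradius_lt hS
    (show circumradius S < circumradius S + ε / 2 by linarith)
  have h0 := circumradius_nonneg S
  have := (diam_mono hc isBounded_closedBall).trans (diam_closedBall (by positivity))
  linarith

theorem circumradius_mono {S T : Set E} (hT : Bornology.IsBounded T) (h : S ⊆ T) :
    circumradius S ≤ circumradius T := by
  refine le_of_forall_pos_le_add fun ε hε => ?_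
  obtain ⟨c, hc⟩ := exists_subset_closedBall_of_circumradius_lt hT
    (show circumradius T < circumradius T + ε by linarith)
  exact circumradius_le (add_nonneg (circumradius_nonneg T) hε.le) (h.trans hc)

/-- A nonempty bounded set in a proper space has a circumcentre. -/
theorem exists_subset_closedBall_circumradius [ProperSpace E] {S : Set E} (hS : S.Nonempty)
    (hb : Bornology.IsBounded S) : ∃ c, S ⊆ closedBall c (circumradius S) := by
  obtain ⟨x₀, hx₀⟩ := hS
  set R := circumradius S with hR
  have hR0 : 0 ≤ R := circumradius_nonneg S
  -- Pairs (centre, radius) of balls containing `S`, truncated to a compact set; a pair of least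
  -- radius gives the circumcentre.
  set T : Set (E × ℝ) := (⋂ x ∈ S, {p : E × ℝ | dist x p.1 ≤ p.2}) ∩
    (closedBall x₀ (R + 1) ×ˢ Icc 0 (R + 1)) with hT
  have hcl : IsClosed (⋂ x ∈ S, {p : E × ℝ | dist x p.1 ≤ p.2}) :=
    isClosed_biInter fun x _ => isClosed_le (by fun_prop) (by fun_prop)
  have hcomp : IsCompact T :=
    ((isCompact_closedBall _ _).prod isCompact_Icc).inter_left hcl
  have hmem : ∀ a, R < a → a ≤ R + 1 → ∃ c, (c, a) ∈ T := by
    intro a h1 h2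
    obtain ⟨c, hc⟩ := exists_subset_closedBall_of_circumradius_lt hb h1
    refine ⟨c, mem_iInter₂.2 fun x hx => hc hx, ?_, by linarith, h2⟩
    have := hc hx₀
    rw [mem_closedBall] at this ⊢
    rw [dist_comm]
    exact this.trans h2
  obtain ⟨c₁, hc₁⟩ := hmem (R + 1) (by linarith) le_rfl
  obtain ⟨p, hp, hmin⟩ := hcomp.exists_isMinOn ⟨_, hc₁⟩ continuous_snd.continuousOn
  have hpR : p.2 ≤ R := by
    refine le_of_forall_gt_imp_ge_of_dense fun a ha => ?_
    obtain ⟨c, hc⟩ := hmem (min a (R + 1)) (lt_min ha (by linarith)) (min_le_right _ _)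
    exact (hmin hc).trans (min_le_left _ _)
  exact ⟨p.1, fun x hx => ((mem_iInter₂.1 hp.1 x hx : dist x p.1 ≤ p.2).trans hpR)⟩

theorem circumradius_le_add_hausdorffDist (L M : NonemptyCompacts E) :
    circumradius (L : Set E) ≤ circumradius (M : Set E) + dist L M := by
  refine le_of_forall_pos_le_add fun ε hε => ?_
  have h0 := circumradius_nonneg (M : Set E)
  obtain ⟨c, hc⟩ := exists_subset_closedBall_of_circumradius_lt M.isCompact.isBounded
    (show circumradius (M : Set E) < circumradius (M : Set E) + ε / 2 by linarith)
  refine circumradius_le (c := c) (by positivity) fun x hx => ?_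
  obtain ⟨y, hy, hxy⟩ := exists_dist_lt_of_hausdorffDist_lt (r := dist L M + ε / 2) hx
    (by rw [NonemptyCompacts.dist_eq]; linarith)
    (hausdorffEDist_ne_top_of_nonempty_of_bounded L.nonempty M.nonempty L.isCompact.isBounded
      M.isCompact.isBounded)
  have := mem_closedBall.1 (hc hy)
  have := dist_triangle x y c
  rw [mem_closedBall]
  linarith

theorem lipschitzWith_circumradius :
    LipschitzWith 1 fun L : NonemptyCompacts E => circumradius (L : Set E) :=
  LipschitzWith.of_le_add circumradius_le_add_hausdorffDist

theorem isClosed_setOf_forall_dist_le (d : ℝ) :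
    IsClosed {L : NonemptyCompacts E | ∀ x ∈ L, ∀ y ∈ L, dist x y ≤ d} := by
  refine isClosed_of_closure_subset fun L hL x hx y hy => ?_
  refine le_of_forall_pos_le_add fun ε hε => ?_
  obtain ⟨M, hM, hLM⟩ := Metric.mem_closure_iff.1 hL (ε / 2) (by positivity)
  rw [NonemptyCompacts.dist_eq] at hLM
  have hfin := hausdorffEDist_ne_top_of_nonempty_of_bounded L.nonempty M.nonempty
    L.isCompact.isBounded M.isCompact.isBounded
  obtain ⟨x', hx', hxx'⟩ := exists_dist_lt_of_hausdorffDist_lt hx hLM hfin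
  obtain ⟨y', hy', hyy'⟩ := exists_dist_lt_of_hausdorffDist_lt hy hLM hfin
  have := hM x' hx' y' hy'
  have := dist_triangle4_right x y x' y'
  linarith

/-- Among the compact sets of diameter at most one that lie in the unit ball, one has the largest
circumradius. -/
theorem exists_maximal_circumradius [ProperSpace E] :
    ∃ L : NonemptyCompacts E, (∀ x ∈ L, ∀ y ∈ L, dist x y ≤ 1) ∧
      ∀ M : NonemptyCompacts E, (M : Set E) ⊆ closedBall 0 1 →
        (∀ x ∈ M, ∀ y ∈ M, dist x y ≤ 1) →
          circumradius (M : Set E) ≤ circumradius (L : Set E) := by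
  -- Blaschke selection: the compact subsets of the unit ball form a compact space in the Hausdorff
  -- metric.
  have hc := (NonemptyCompacts.isCompact_subsets_of_isCompact
    (isCompact_closedBall (0 : E) 1)).inter_right (isClosed_setOf_forall_dist_le (E := E) 1)
  have hne : ({0} : NonemptyCompacts E) ∈ {L : NonemptyCompacts E | (L : Set E) ⊆ closedBall 0 1} ∩
      {L : NonemptyCompacts E | ∀ x ∈ L, ∀ y ∈ L, dist x y ≤ 1} := by
    refine ⟨?_, ?_⟩
    · simp
    · intro x hx y hy
      rw [← SetLike.mem_coe, NonemptyCompacts.coe_singleton, mem_singleton_iff] at hx hy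
      simp [hx, hy]
  obtain ⟨L, hL, hmax⟩ := hc.exists_isMaxOn ⟨_, hne⟩
    lipschitzWith_circumradius.continuous.continuousOn
  exact ⟨L, hL.2, fun M h1 h2 => hmax ⟨h1, h2⟩⟩

end Circumradius

variable [NormedSpace ℝ E]

/-- The point of the inner ball farthest from `x` lies at distance `dist c x + ρ`, straight away
from `x`. -/
theorem dist_add_le_of_closedBall_subset [Nontrivial E] {c x : E} {ρ D : ℝ} (hρ : 0 ≤ ρ)
    (h : closedBall c ρ ⊆ closedBall x D) : dist c x + ρ ≤ D := by
  obtain ⟨v, hv, hvc⟩ : ∃ v : E, ‖v‖ = 1 ∧ c - x = ‖c - x‖ • v := by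
    by_cases hcx : c - x = 0
    · obtain ⟨v, hv⟩ := exists_norm_eq E zero_le_one
      exact ⟨v, hv, by simp [hcx]⟩
    · exact ⟨‖c - x‖⁻¹ • (c - x), norm_smul_inv_norm hcx,
        by rw [smul_inv_smul₀ (norm_ne_zero_iff.2 hcx)]⟩
  have hmem : c + ρ • v ∈ closedBall c ρ := by
    simp [mem_closedBall, dist_eq_norm, norm_smul, hv, abs_of_nonneg hρ]
  have h1 := mem_closedBall.1 (h hmem)
  have h2 : c + ρ • v - x = (‖c - x‖ + ρ) • v := by
    rw [add_smul, ← hvc]; abel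
  rwa [dist_eq_norm, h2, norm_smul, hv, mul_one, Real.norm_of_nonneg (by positivity),
    ← dist_eq_norm] at h1

/-- A set of positive diameter bound `d` is contained in a complete body of diameter `d`. -/
theorem exists_completion [FiniteDimensional ℝ E] [Nontrivial E] {S : Set E} (hS : S.Nonempty)
    {d : ℝ} (hd : 0 < d) (hSd : ∀ x ∈ S, ∀ y ∈ S, dist x y ≤ d) :
    ∃ K ∈ completeBodies E, S ⊆ K ∧ diam (K : Set E) = d := by
  obtain ⟨M, hSM, hM⟩ := zorn_subset_nonempty {S : Set E | ∀ x ∈ S, ∀ y ∈ S, dist x y ≤ d}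
    (fun C hC hchain _ => ⟨⋃₀ C, by
      rintro x ⟨A, hA, hx⟩ y ⟨B, hB, hy⟩
      rcases hchain.total hA hB with h | h
      · exact hC hB x (h hx) y hy
      · exact hC hA x hx y (h hy), fun s hs => subset_sUnion_of_mem hs⟩) S hSd
  have hMd : ∀ x ∈ M, ∀ y ∈ M, dist x y ≤ d := hM.1
  have hmem : ∀ x, (∀ y ∈ M, dist x y ≤ d) → x ∈ M := by
    intro x hx
    refine hM.2 (y := insert x M) ?_ (subset_insert x M) (mem_insert x M)
    rintro a (rfl | ha) b (rfl | hb)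
    · simpa using hd.le
    · exact hx b hb
    · rw [dist_comm]; exact hx a ha
    · exact hMd a ha b hb
  have hinter : M = ⋂ y ∈ M, closedBall y d := by
    ext x
    simp only [mem_iInter, mem_closedBall]
    exact ⟨fun hx y hy => hMd x hx y hy, hmem x⟩
  have hMne : M.Nonempty := hS.mono hSM
  obtain ⟨m, hm⟩ := hMne
  have hconv : Convex ℝ M := by
    rw [hinter]; exact convex_iInter₂ fun y _ => convex_closedBall y d
  have hclosed : IsClosed M := by
    rw [hinter]; exact isClosed_biInter fun y _ => isClosed_closedBall
  have hbdd : Bornology.IsBounded M :=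
    isBounded_closedBall.subset fun x hx => mem_closedBall.2 (hMd x hx m hm)
  have : ProperSpace E := FiniteDimensional.proper ℝ E
  have hdiam : diam M = d := by
    refine (diam_le_of_forall_dist_le hd.le hMd).antisymm ?_
    by_contra! hlt
    -- By maximality the ball of radius `d - diam M` about `x` lies in `M`, hence within `diam M` of
    -- `y`. This lowers every distance in `M` by a fixed positive amount, which is absurd.
    have hpt : ∀ x ∈ M, ∀ y ∈ M, dist x y + (d - diam M) ≤ diam M := by
      intro x hx y hy
      refine dist_add_le_of_closedBall_subset (by linarith) fun z hz => ?_
      refine mem_closedBall.2 (dist_le_diam_of_mem hbdd (hmem z fun w hw => ?_) hy)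
      have := mem_closedBall.1 hz
      have := dist_le_diam_of_mem hbdd hx hw
      have := dist_triangle z x w
      linarith
    have h0 := hpt m hm m hm
    rw [dist_self] at h0
    have := diam_le_of_forall_dist_le (C := diam M - (d - diam M)) (by linarith)
      fun x hx y hy => by linarith [hpt x hx y hy]
    linarith
  refine ⟨⟨M, hconv, isCompact_of_isClosed_isBounded hclosed hbdd, m, hm⟩, ⟨?_, ?_⟩, hSM, hdiam⟩
  · change M.Nontrivial
    by_contra hnt
    rw [not_nontrivial_iff] at hnt
    linarith [diam_subsingleton hnt]
  · intro x hx
    change x ∉ M at hx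
    change diam M < diam (M ∪ {x})
    obtain ⟨y, hy, hxy⟩ : ∃ y ∈ M, d < dist x y := by
      by_contra! h
      exact hx (hmem x h)
    rw [hdiam]
    exact hxy.trans_le (dist_le_diam_of_mem (hbdd.union Bornology.isBounded_singleton)
      (Or.inr rfl) (Or.inl hy))

/-! ### Radii, asymmetry and Jung ratio of complete bodies. -/

section Bodies

theorem diam_pos {K : ConvexBody E} (hK : K ∈ bodies E) : 0 < diam (K : Set E) := by
  obtain ⟨x, hx, y, hy, hxy⟩ := hK
  exact (dist_pos.2 hxy).trans_le (dist_le_diam_of_mem K.isCompact.isBounded hx hy)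

theorem mem_of_forall_dist_le {K : ConvexBody E} (hK : K ∈ completeBodies E) {x : E}
    (hx : ∀ y ∈ (K : Set E), dist x y ≤ diam (K : Set E)) : x ∈ (K : Set E) := by
  by_contra hxK
  refine (hK.2 x hxK).not_ge (diam_le_of_forall_dist_le diam_nonneg ?_)
  rintro a (ha | rfl) b (hb | rfl)
  · exact dist_le_diam_of_mem K.isCompact.isBounded ha hb
  · rw [dist_comm]; exact hx a ha
  · exact hx b hb
  · simpa using diam_nonneg

theorem circumradius_pos {K : ConvexBody E} (hK : K ∈ bodies E) :
    0 < circumradius (K : Set E) := by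
  linarith [diam_pos hK, diam_le_two_mul_circumradius K.isCompact.isBounded]

/-- The average of a finite `D / 2`-net of `K` is at distance less than `D` from all of `K`. -/
theorem circumradius_lt_diam {K : ConvexBody E} (hK : K ∈ bodies E) :
    circumradius (K : Set E) < diam (K : Set E) := by
  classical
  set D := diam (K : Set E) with hD
  have hD0 : 0 < D := diam_pos hK
  obtain ⟨t, htK, htf, hcov⟩ := K.isCompact.finite_cover_balls (half_pos hD0)
  lift t to Finset E using htf
  obtain ⟨x₀, hx₀⟩ := K.nonempty
  have htne : t.Nonempty := by
    obtain ⟨y, hy, -⟩ := mem_iUnion₂.1 (hcov hx₀)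
    exact ⟨y, hy⟩
  have hcard : (0 : ℝ) < t.card := by exact_mod_cast htne.card_pos
  set c : E := (t.card : ℝ)⁻¹ • ∑ y ∈ t, y with hc
  have hbound : ∀ x ∈ (K : Set E), dist x c ≤ D - (t.card : ℝ)⁻¹ * (D / 2) := by
    intro x hx
    obtain ⟨y, hy, hxy⟩ := mem_iUnion₂.1 (hcov hx)
    have h1 : x - c = (t.card : ℝ)⁻¹ • ∑ z ∈ t, (x - z) := by
      rw [Finset.sum_sub_distrib, Finset.sum_const, smul_sub, ← hc, ← Nat.cast_smul_eq_nsmul ℝ,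
        inv_smul_smul₀ hcard.ne']
    -- The net point `y` near `x` contributes less than `D / 2`, every other one at most `D`.
    have h2 : ∑ z ∈ t, ‖x - z‖ ≤ t.card * D - D / 2 := by
      have hle : ∀ z ∈ t.erase y, ‖x - z‖ ≤ D := fun z hz => by
        rw [← dist_eq_norm]
        exact dist_le_diam_of_mem K.isCompact.isBounded hx (htK (Finset.mem_of_mem_erase hz))
      have h3 := Finset.sum_le_card_nsmul _ _ _ hle
      rw [Finset.card_erase_of_mem hy, nsmul_eq_mul, Nat.cast_sub htne.card_pos, Nat.cast_one] at h3
      rw [← Finset.add_sum_erase t _ hy]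
      have h4 : ‖x - y‖ < D / 2 := by rw [← dist_eq_norm]; exact hxy
      linarith
    rw [dist_eq_norm, h1, norm_smul, Real.norm_of_nonneg (by positivity)]
    calc (t.card : ℝ)⁻¹ * ‖∑ z ∈ t, (x - z)‖
        ≤ (t.card : ℝ)⁻¹ * (t.card * D - D / 2) := by
          gcongr
          exact (norm_sum_le _ _).trans h2
      _ = D - (t.card : ℝ)⁻¹ * (D / 2) := by field_simp
  have hpos : 0 < (t.card : ℝ)⁻¹ * (D / 2) := by positivity
  have := circumradius_le (dist_nonneg.trans (hbound x₀ hx₀)) fun x hx =>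
    mem_closedBall.2 (hbound x hx)
  linarith

theorem nontrivial_of_mem_bodies {K : ConvexBody E} (hK : K ∈ bodies E) : Nontrivial E := by
  obtain ⟨x, -, y, -, hxy⟩ := hK
  exact ⟨x, y, hxy⟩

/-- If `-x = c + ρ y`, then `-c / (ρ + 1)` divides the segment from `x` to `y` at the fraction `ρ /
(ρ + 1)`, whatever `x` is. -/
theorem circumradius_le_of_neg_subset {K : ConvexBody E} {ρ : ℝ} (hρ : 0 < ρ) {c : E}
    (h : -(K : Set E) ⊆ c +ᵥ (ρ • (K : Set E))) :
    circumradius (K : Set E) ≤ diam (K : Set E) * ρ / (ρ + 1) := by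
  have hD : 0 ≤ diam (K : Set E) := diam_nonneg
  refine circumradius_le (c := -((ρ + 1)⁻¹ • c)) (by positivity) fun x hx => ?_
  obtain ⟨_, ⟨y, hy, rfl⟩, hxy⟩ := mem_vadd_set.1 (h (neg_mem_neg.2 hx))
  have hxy' : c = -x - ρ • y := by rw [← hxy]; simp
  have hd := dist_le_diam_of_mem K.isCompact.isBounded hx hy
  have heq : x - -((ρ + 1)⁻¹ • c) = (ρ / (ρ + 1)) • (x - y) := by
    rw [hxy']
    match_scalars <;> field_simp
    ring
  rw [mem_closedBall, dist_eq_norm, heq, norm_smul, Real.norm_of_nonneg (by positivity),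
    ← dist_eq_norm, mul_div_assoc, mul_comm]
  gcongr

variable [FiniteDimensional ℝ E]

/-- The insphere and circumsphere of a complete body are concentric and their radii sum to the
diameter. -/
theorem exists_concentric_closedBalls {K : ConvexBody E} (hK : K ∈ completeBodies E) :
    ∃ c, (K : Set E) ⊆ closedBall c (circumradius (K : Set E)) ∧
      closedBall c (diam (K : Set E) - circumradius (K : Set E)) ⊆ K := by
  have : ProperSpace E := FiniteDimensional.proper ℝ E
  obtain ⟨c, hc⟩ := exists_subset_closedBall_circumradius K.nonempty K.isCompact.isBounded
  refine ⟨c, hc, fun z hz => mem_of_forall_dist_le hK fun y hy => ?_⟩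
  have := mem_closedBall.1 hz
  have := mem_closedBall'.1 (hc hy)
  have := dist_triangle z c y
  linarith

theorem inradius_eq {K : ConvexBody E} (hK : K ∈ completeBodies E) :
    inradius (K : Set E) = diam (K : Set E) - circumradius (K : Set E) := by
  have := nontrivial_of_mem_bodies hK.1
  refine IsGreatest.csSup_eq ⟨⟨sub_pos.2 (circumradius_lt_diam hK.1), ?_⟩, ?_⟩
  · obtain ⟨c, -, hc⟩ := exists_concentric_closedBalls hK
    exact ⟨c, hc⟩
  · rintro ρ ⟨hρ, c, hc⟩
    have hsub : ∀ x ∈ (K : Set E), dist x c ≤ diam (K : Set E) - ρ := fun x hx => by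
      have := dist_add_le_of_closedBall_subset (D := diam (K : Set E)) (x := x) hρ.le fun z hz =>
        mem_closedBall.2 (dist_le_diam_of_mem K.isCompact.isBounded (hc hz) hx)
      rw [dist_comm]
      linarith
    obtain ⟨x, hx⟩ := K.nonempty
    have := circumradius_le (dist_nonneg.trans (hsub x hx)) fun y hy => mem_closedBall.2 (hsub y hy)
    linarith

theorem asymmetry_eq {K : ConvexBody E} (hK : K ∈ completeBodies E) :
    asymmetry (K : Set E) =
      circumradius (K : Set E) / (diam (K : Set E) - circumradius (K : Set E)) := by
  have hR := circumradius_pos hK.1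
  have hr := sub_pos.2 (circumradius_lt_diam hK.1)
  refine IsLeast.csInf_eq ⟨⟨by positivity, ?_⟩, ?_⟩
  · obtain ⟨c, hcR, hcr⟩ := exists_concentric_closedBalls hK
    set R := circumradius (K : Set E)
    set r := diam (K : Set E) - R
    -- Scaling by `R / r` followed by this translation carries the inscribed ball about `c` onto the
    -- ball of radius `R` about `-c`, which contains `-K`.
    refine ⟨-c - (R / r) • c, fun x hx => ?_⟩
    refine mem_vadd_set.2 ⟨(R / r) • (c + (r / R) • (x + c)), smul_mem_smul_set (hcr ?_), ?_⟩
    · have h1 := mem_closedBall.1 (hcR (mem_neg.1 hx))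
      rw [dist_eq_norm, ← norm_neg, neg_sub, sub_neg_eq_add, add_comm] at h1
      rw [mem_closedBall, dist_eq_norm, add_sub_cancel_left, norm_smul,
        Real.norm_of_nonneg (by positivity)]
      calc r / R * ‖x + c‖ ≤ r / R * R := by gcongr
        _ = r := by field_simp
    · rw [smul_add, smul_smul, vadd_eq_add]
      have : R / r * (r / R) = 1 := by field_simp
      rw [this, one_smul]
      abel
  · rintro ρ ⟨hρ, c, hc⟩
    have h := circumradius_le_of_neg_subset hρ hc
    rw [le_div_iff₀ (by positivity)] at h
    rw [div_le_iff₀ hr]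
    linarith

/-- The Jung ratio of any body is at most that of some fixed complete body. -/
theorem exists_complete_maximal_jungRatio [Nontrivial E] :
    ∃ K ∈ completeBodies E, ∀ L ∈ bodies E,
      jungRatio (L : Set E) ≤ jungRatio (K : Set E) := by
  have : ProperSpace E := FiniteDimensional.proper ℝ E
  obtain ⟨M, hM, hmax⟩ := exists_maximal_circumradius (E := E)
  obtain ⟨K, hK, hMK, hdiam⟩ := exists_completion M.nonempty one_pos hM
  refine ⟨K, hK, fun L hL => ?_⟩
  have hd := diam_pos hL
  set d := diam (L : Set E)
  rw [jungRatio, jungRatio, hdiam, div_one, div_le_iff₀ hd]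
  refine le_trans ?_ (mul_le_mul_of_nonneg_right
    (circumradius_mono K.isCompact.isBounded hMK) hd.le)
  obtain ⟨a, ha⟩ := L.nonempty
  -- Normalising to diameter one, with a point of the body at the origin, brings `L` into the
  -- compact family where `M` is maximal.
  let N : NonemptyCompacts E := ⟨⟨(fun x => d⁻¹ • (x - a)) '' L,
    L.isCompact.image (by fun_prop)⟩, L.nonempty.image _⟩
  have hdist : ∀ x ∈ (L : Set E), ∀ y ∈ (L : Set E),
      dist (d⁻¹ • (x - a)) (d⁻¹ • (y - a)) ≤ 1 := by
    intro x hx y hy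
    rw [dist_smul₀, dist_sub_right, Real.norm_of_nonneg (by positivity), inv_mul_le_one₀ hd]
    exact dist_le_diam_of_mem L.isCompact.isBounded hx hy
  have hN : circumradius (N : Set E) ≤ circumradius (M : Set E) := by
    refine hmax N ?_ ?_
    · rintro _ ⟨x, hx, rfl⟩
      simpa using hdist x hx a ha
    · rintro _ ⟨x, hx, rfl⟩ _ ⟨y, hy, rfl⟩
      exact hdist x hx y hy
  obtain ⟨c, hc⟩ := exists_subset_closedBall_circumradius N.nonempty N.isCompact.isBounded
  refine circumradius_le (c := a + d • c) (mul_nonneg (circumradius_nonneg _) hd.le) fun x hx => ?_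
  have h1 := (mem_closedBall.1 (hc ⟨x, hx, rfl⟩)).trans hN
  have h2 : x - (a + d • c) = d • (d⁻¹ • (x - a) - c) := by
    rw [smul_sub, smul_inv_smul₀ hd.ne']; abel
  rw [mem_closedBall, dist_eq_norm, h2, norm_smul, Real.norm_of_nonneg hd.le, ← dist_eq_norm,
    mul_comm]
  exact mul_le_mul_of_nonneg_right h1 hd.le

theorem asymmetry_pos {K : ConvexBody E} (hK : K ∈ completeBodies E) :
    0 < asymmetry (K : Set E) := by
  rw [asymmetry_eq hK]
  exact div_pos (circumradius_pos hK.1) (sub_pos.2 (circumradius_lt_diam hK.1))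

theorem inradius_div_diam_eq {K : ConvexBody E} (hK : K ∈ completeBodies E) :
    inradius (K : Set E) / diam (K : Set E) = 1 / (asymmetry (K : Set E) + 1) := by
  have hr := sub_pos.2 (circumradius_lt_diam hK.1)
  have hD := diam_pos hK.1
  rw [inradius_eq hK, asymmetry_eq hK, div_add_one hr.ne', add_sub_cancel, one_div_div]

theorem jungRatio_eq {K : ConvexBody E} (hK : K ∈ completeBodies E) :
    jungRatio (K : Set E) = 1 - 1 / (asymmetry (K : Set E) + 1) := by
  rw [← inradius_div_diam_eq hK, inradius_eq hK, sub_div, div_self (diam_pos hK.1).ne', jungRatio]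
  ring

theorem asymmetry_le_iff {K L : ConvexBody E} (hK : K ∈ completeBodies E)
    (hL : L ∈ completeBodies E) :
    asymmetry (K : Set E) ≤ asymmetry (L : Set E) ↔
      jungRatio (K : Set E) ≤ jungRatio (L : Set E) := by
  have h1 := asymmetry_pos hK
  have h2 := asymmetry_pos hL
  rw [jungRatio_eq hK, jungRatio_eq hL, sub_le_sub_iff_left,
    one_div_le_one_div (by positivity) (by positivity), add_le_add_iff_right]

end Bodies

end MinkowskiSpace

open MinkowskiSpace in
theorem mainTheorem6 {E : Type*} [NormedAddCommGroup E] [NormedSpace ℝ E]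
    [FiniteDimensional ℝ E] (K : ConvexBody E) (hK : K ∈ MinkowskiSpace.completeBodies E) :
    IsGreatest (MinkowskiSpace.completeAsymmetries E) (MinkowskiSpace.asymmetryConstant E) ∧
    IsLUB (MinkowskiSpace.jungRatios E) (MinkowskiSpace.jungConstant E) ∧
    MinkowskiSpace.inradius (K : Set E) / Metric.diam (K : Set E) =
      1 / (MinkowskiSpace.asymmetry (K : Set E) + 1) ∧
    1 / (MinkowskiSpace.asymmetryConstant E + 1) ≤
      1 / (MinkowskiSpace.asymmetry (K : Set E) + 1) ∧
    (1 / (MinkowskiSpace.asymmetry (K : Set E) + 1) =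
        1 / (MinkowskiSpace.asymmetryConstant E + 1) ↔
      MinkowskiSpace.jungRatio (K : Set E) = MinkowskiSpace.jungConstant E) := by
  have := nontrivial_of_mem_bodies hK.1
  obtain ⟨M, hM, hmax⟩ := exists_complete_maximal_jungRatio (E := E)
  have hs : IsGreatest (completeAsymmetries E) (asymmetry (M : Set E)) := by
    refine ⟨⟨M, hM, rfl⟩, ?_⟩
    rintro _ ⟨L, hL, rfl⟩
    exact (asymmetry_le_iff hL hM).2 (hmax L hL.1)
  have hj : IsGreatest (jungRatios E) (jungRatio (M : Set E)) := by
    refine ⟨⟨M, hM.1, rfl⟩, ?_⟩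
    rintro _ ⟨L, hL, rfl⟩
    exact hmax L hL
  have hs' : asymmetryConstant E = asymmetry (M : Set E) := hs.csSup_eq
  have hj' : jungConstant E = jungRatio (M : Set E) := hj.csSup_eq
  rw [hs', hj']
  refine ⟨hs, hj.isLUB, inradius_div_diam_eq hK, ?_, ?_⟩
  · exact one_div_le_one_div_of_le (add_pos (asymmetry_pos hK) one_pos)
      (add_le_add_left (hs.2 ⟨K, hK, rfl⟩) 1)
  · rw [jungRatio_eq hK, jungRatio_eq hM, sub_right_inj]
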